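/- **Setting.** Let $\Omega\subset\mathbb R^d$ be compact and convex, $m\ge 1$, $\alpha_1,\dots,\alpha_m>0$ with $\sum_i\alpha_i=1$, and let $\mu_1,\dots,\mu_m$ be probability measures on $\Omega$ that are absolutely continuous with respect to the Lebesgue measure. For $f:\Omega\to\mathbb R$ put $f^c(x)=\inf_{y\in\Omega}\{\tfrac12\|x-y\|_2^2-f(y)\}$ and $T_{f^c}=\mathrm{id}-\nabla f^c$; $f$ is $c$-concave if $f=g^c$ for some $g$. Let $\dot{\mathbb H}^1$ be the space of $f$ on $\Omega$ with $\int_\Omega f\,dx=0$ and square integrable weak gradient, with $\langle f,g\rangle_{\dot{\mathbb H}^1}=\int_\Omega\langle\nabla f,\nabla g\rangle dx$ and the induced (semi)norm, and for probability measures put $\|\nu-\nu'\|_{\dot{\mathbb H}^{-1}}=\sup\{\int_\Omega\phi\,d(\nu-\nu'):\phi\in\dot{\mathbb H}^1\cap C(\Omega),\ \|\phi\|_{\dot{\mathbb H}^1}\le1\}$. For $\mathbf f=(f_1,\dots,f_{m-1})$ let $$\mathcal D(\mathbf f)=\sum_{i=1}^{m-1}\alpha_i\int_\Omega f_i^c\,d\mu_i+\alpha_m\int_\Omega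 f_{\rm mix}^c\,d\mu_m,\qquad f_{\rm mix}=-\sum_{i=1}^{m-1}\frac{\alpha_i}{\alpha_m}f_i .$$ The $\dot{\mathbb H}^1$-gradient $\boldsymbol\nabla_{f_i}\mathcal D(\mathbf f)\in\dot{\mathbb H}^1$ is the Riesz representative of the Gateaux derivative of $\mathcal D$ in its $i$-th argument, in the directions $h\in\dot{\mathbb H}^1\cap C(\Omega)$. **Algorithm.** Let $T\ge1$ and let $f_i^{(0)}$ have a square integrable weak gradient. Assume that for $t=1,\dots,T$ and $i=1,\dots,m-1$ (in parallel) the gradient exists and $$f_i^{(t)}=f_i^{(t-1)}+\eta_{t-1}\boldsymbol\nabla_{f_i}\mathcal D(f_1^{(t-1)},\dots,f_{m-1}^{(t-1)}),$$ and that all $f_i^{(t)}$, $0\le t\le T$, are continuous on $\Omega$. Let $\tilde{\mathbf f}=(\tilde f_1,\dots,\tilde f_{m-1})$ be any maximizer of $\mathcal D$ over continuous functions all of whose components are $c$-concave, let $R=(\sum_{i=1}^{m-1}\|f_i^{(0)}-\tilde f_i\|_{\dot{\mathbb H}^1}^2)^{1/2}$, let $\mathbf f^{(\rm best)}$ satisfy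 $\mathcal D(\mathbf f^{(\rm best)})\ge\max_{1\le t\le T}\mathcal D(\mathbf f^{(t-1)})$, and let $M<\infty$ be any number with $$M\ \ge\ \max_{1\le t\le T}\Big(\sum_{i=1}^{m-1}\alpha_i^2\,\big\|(T_{(f_i^{(t-1)})^c})_\#\mu_i-(T_{(f_{\rm mix}^{(t-1)})^c})_\#\mu_m\big\|_{\dot{\mathbb H}^{-1}}^2\Big)^{1/2}$$ (for example this maximum itself, or the same expression with $\alpha_i$ in place of $\alpha_i^2$). The step size is read as $0$ if $M=0$. **Theorem.** (i) If $\eta_{t-1}=R/(M\sqrt T)$ for $t=1,\dots,T$, then $$\mathcal D(\tilde{\mathbf f})-\mathcal D(\mathbf f^{(\rm best)})\le M\,R\,\frac1{\sqrt T}.$$ (ii) If $\eta_{t-1}=R/(M\sqrt t)$ for $t=1,\dots,T$, then $$\mathcal D(\tilde{\mathbf f})-\mathcal D(\mathbf f^{(\rm best)})\le M\,R\,\frac{\ln T+2}{\sqrt T}.$$ -/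

import Mathlib

open MeasureTheory Set
open scoped ENNReal NNReal ContDiff

noncomputable section

/-- `f` is integrable on `Ω` and `G` is its weak gradient on the interior of `Ω`, with `G` square
integrable on `Ω` (for convex `Ω` the boundary is Lebesgue null). -/
def IsWeakGrad {d : ℕ} (Ω : Set (EuclideanSpace ℝ (Fin d))) (f : EuclideanSpace ℝ (Fin d) → ℝ)
    (G : EuclideanSpace ℝ (Fin d) → EuclideanSpace ℝ (Fin d)) : Prop :=
  IntegrableOn f Ω volume ∧ MemLp G 2 (volume.restrict Ω) ∧
    ∀ φ : EuclideanSpace ℝ (Fin d) → ℝ, ContDiff ℝ ∞ φ → HasCompactSupport φ →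
      tsupport φ ⊆ interior Ω → ∀ v : EuclideanSpace ℝ (Fin d),
        ∫ x in Ω, f x * fderiv ℝ φ x v = -∫ x in Ω, φ x * inner ℝ (G x) v

/-- `f` has a square integrable weak gradient on `Ω` (no normalization of its mean). -/
def HasWeakGrad {d : ℕ} (Ω : Set (EuclideanSpace ℝ (Fin d)))
    (f : EuclideanSpace ℝ (Fin d) → ℝ) : Prop :=
  ∃ G, IsWeakGrad Ω f G

open Classical in
/-- The weak gradient of `f` on `Ω` (unique almost everywhere when it exists). -/
def weakGrad {d : ℕ} (Ω : Set (EuclideanSpace ℝ (Fin d))) (f : EuclideanSpace ℝ (Fin d) → ℝ) :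
    EuclideanSpace ℝ (Fin d) → EuclideanSpace ℝ (Fin d) :=
  if h : HasWeakGrad Ω f then h.choose else 0

/-- Membership in the homogeneous Sobolev space: square integrable weak gradient, mean zero. -/
def MemHdot {d : ℕ} (Ω : Set (EuclideanSpace ℝ (Fin d)))
    (f : EuclideanSpace ℝ (Fin d) → ℝ) : Prop :=
  HasWeakGrad Ω f ∧ ∫ x in Ω, f x = 0

/-- The homogeneous Sobolev inner product `∫_Ω ⟨∇f, ∇g⟩ dx`. -/
def hdotInner {d : ℕ} (Ω : Set (EuclideanSpace ℝ (Fin d)))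
    (f g : EuclideanSpace ℝ (Fin d) → ℝ) : ℝ :=
  ∫ x in Ω, inner ℝ (weakGrad Ω f x) (weakGrad Ω g x)

/-- The homogeneous Sobolev norm. -/
def hdotNorm {d : ℕ} (Ω : Set (EuclideanSpace ℝ (Fin d)))
    (f : EuclideanSpace ℝ (Fin d) → ℝ) : ℝ :=
  √(hdotInner Ω f f)

/-- The product distance `(∑ i, ‖f i - g i‖²)^(1/2)` in the homogeneous Sobolev norm. -/
def hdotDist {d n : ℕ} (Ω : Set (EuclideanSpace ℝ (Fin d)))
    (f g : Fin n → EuclideanSpace ℝ (Fin d) → ℝ) : ℝ :=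
  √(∑ i, hdotNorm Ω (f i - g i) ^ 2)

/-- The dual norm of the difference of two measures (possibly infinite):
the supremum of `∫_Ω φ dν - ∫_Ω φ dν'` over continuous `φ` in the unit ball of the homogeneous
Sobolev space. Continuity makes the integrals against measures without density meaningful. -/
def hdotNegNorm {d : ℕ} (Ω : Set (EuclideanSpace ℝ (Fin d)))
    (ν ν' : Measure (EuclideanSpace ℝ (Fin d))) : ℝ≥0∞ :=
  ⨆ (φ : EuclideanSpace ℝ (Fin d) → ℝ)
    (_ : MemHdot Ω φ ∧ ContinuousOn φ Ω ∧ hdotNorm Ω φ ≤ 1),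
    ENNReal.ofReal ((∫ x in Ω, φ x ∂ν) - ∫ x in Ω, φ x ∂ν')

/-- The `c`-transform on `Ω` for the cost `c(x, y) = ‖x - y‖² / 2`. -/
def cTransform {d : ℕ} (Ω : Set (EuclideanSpace ℝ (Fin d))) (f : EuclideanSpace ℝ (Fin d) → ℝ)
    (x : EuclideanSpace ℝ (Fin d)) : ℝ :=
  ⨅ y : Ω, (‖x - (y : EuclideanSpace ℝ (Fin d))‖ ^ 2 / 2 - f y)

/-- `f` agrees on `Ω` with the `c`-transform of some function; boundedness above of that function
on `Ω` says exactly that its `c`-transform is real valued. -/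
def IsCConcave {d : ℕ} (Ω : Set (EuclideanSpace ℝ (Fin d)))
    (f : EuclideanSpace ℝ (Fin d) → ℝ) : Prop :=
  ∃ g : EuclideanSpace ℝ (Fin d) → ℝ, BddAbove (g '' Ω) ∧ ∀ x ∈ Ω, f x = cTransform Ω g x

/-- The map `T_h = id - ∇h`. -/
def transportMap {d : ℕ} (h : EuclideanSpace ℝ (Fin d) → ℝ) (x : EuclideanSpace ℝ (Fin d)) :
    EuclideanSpace ℝ (Fin d) :=
  x - gradient h x

/-- `f_mix = -∑_{i<m} (α_i / α_m) f_i`, where `m = n + 1`. -/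
def fMix {d n : ℕ} (α : Fin (n + 1) → ℝ) (f : Fin n → EuclideanSpace ℝ (Fin d) → ℝ)
    (x : EuclideanSpace ℝ (Fin d)) : ℝ :=
  -∑ i : Fin n, α i.castSucc / α (Fin.last n) * f i x

/-- The dual functional
`𝒟(f_1, …, f_{m-1}) = ∑_{i<m} α_i ∫_Ω f_i^c dμ_i + α_m ∫_Ω f_mix^c dμ_m`, where `m = n + 1`. -/
def dualD {d n : ℕ} (Ω : Set (EuclideanSpace ℝ (Fin d))) (α : Fin (n + 1) → ℝ)
    (μ : Fin (n + 1) → Measure (EuclideanSpace ℝ (Fin d)))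
    (f : Fin n → EuclideanSpace ℝ (Fin d) → ℝ) : ℝ :=
  ∑ i : Fin n, α i.castSucc * ∫ x in Ω, cTransform Ω (f i) x ∂(μ i.castSucc)
    + α (Fin.last n) * ∫ x in Ω, cTransform Ω (fMix α f) x ∂(μ (Fin.last n))

/-- `g` is the Sobolev gradient of `𝒟` at `f` in the `i`-th argument: it lies in the homogeneous
Sobolev space and represents, in its inner product, the Gateaux derivative of `𝒟` in the `i`-th
argument, in every continuous direction of that space. -/
def IsSobolevGradient {d n : ℕ} (Ω : Set (EuclideanSpace ℝ (Fin d))) (α : Fin (n + 1) → ℝ)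
    (μ : Fin (n + 1) → Measure (EuclideanSpace ℝ (Fin d)))
    (f : Fin n → EuclideanSpace ℝ (Fin d) → ℝ) (i : Fin n)
    (g : EuclideanSpace ℝ (Fin d) → ℝ) : Prop :=
  MemHdot Ω g ∧ ∀ h : EuclideanSpace ℝ (Fin d) → ℝ, MemHdot Ω h → ContinuousOn h Ω →
    HasDerivAt (fun ε : ℝ => dualD Ω α μ (Function.update f i (f i + ε • h)))
      (hdotInner Ω g h) 0

/-- `f 0, …, f T` is produced by parallel Sobolev gradient ascent with step sizes
`η 0, …, η (T - 1)`. The Sobolev gradient is a class of functions modulo null sets, so the update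
is an identity almost everywhere on `Ω`. -/
def IsSGASequence {d n : ℕ} (Ω : Set (EuclideanSpace ℝ (Fin d))) (α : Fin (n + 1) → ℝ)
    (μ : Fin (n + 1) → Measure (EuclideanSpace ℝ (Fin d))) (η : ℕ → ℝ) (T : ℕ)
    (f : ℕ → Fin n → EuclideanSpace ℝ (Fin d) → ℝ) : Prop :=
  ∀ t < T, ∀ i, ∃ g, IsSobolevGradient Ω α μ (f t) i g ∧
    f (t + 1) i =ᵐ[volume.restrict Ω] fun x => f t i x + η t * g x

/-- `(∑_{i<m} (α_i ‖(T_{f_i^c})_# μ_i - (T_{f_mix^c})_# μ_m‖)²)^(1/2)` in the dual Sobolev norm. -/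
def pushforwardGap {d n : ℕ} (Ω : Set (EuclideanSpace ℝ (Fin d))) (α : Fin (n + 1) → ℝ)
    (μ : Fin (n + 1) → Measure (EuclideanSpace ℝ (Fin d)))
    (f : Fin n → EuclideanSpace ℝ (Fin d) → ℝ) : ℝ≥0∞ :=
  (∑ i : Fin n, (ENNReal.ofReal (α i.castSucc) *
    hdotNegNorm Ω ((μ i.castSucc).map (transportMap (cTransform Ω (f i))))
      ((μ (Fin.last n)).map (transportMap (cTransform Ω (fMix α f))))) ^ 2) ^ (1 / 2 : ℝ)

end

/-!
Parallel Sobolev gradient ascent is a subgradient method for the dual functional `𝒟`, run in the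
Hilbert space of weak gradients `L²(Ω; ℝᵈ)`; two facts make the textbook analysis apply.

* Supergradients. For continuous `f`, the function `f^c` is locally Lipschitz, so by Rademacher's
  theorem it is differentiable at almost every `x ∈ Ω`, and first order optimality identifies
  `T_{f^c} x = x - ∇f^c x` with a minimizer of `‖x - y‖² / 2 - f y`
  (`transportMap_cTransform_eq`). Testing the infimum for `g^c x` with this minimizer gives
  `g^c x ≤ f^c x - (g - f) (T_{f^c} x)`. Integration yields a supergradient inequality for `𝒟`
  jointly in all arguments (`dualD_le_add_sum_dualSlope`), whose `i`-th slope is the linear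
  functional `dualSlope` given by the difference of the two pushforward measures. The
  one-dimensional restrictions of `𝒟` lie below affine functions with these slopes, so the Sobolev
  gradient, whenever it exists, represents `dualSlope` (`IsSobolevGradient.hdotInner_eq`).

* Norm bound. The slope is bounded by the dual norm of the difference of the pushforward measures,
  which is a supremum over continuous functions only (`abs_dualSlope_le`). A Sobolev gradient used
  with a nonzero step is a difference quotient of continuous iterates, so it is itself an admissible
  direction and its norm obeys the same bound (`IsSobolevGradient.norm_le`).

Expanding the square of the distance to `ftilde`, which is Lipschitz on `Ω` and therefore has a weak
gradient, gives the recursion `hdotDist_sq_step_le`; it telescopes, and the rates follow from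
`∑_{t ≤ T} t^(-1/2) ≥ √T` and `∑_{t ≤ T} 1 / t ≤ 1 + log T`. If `M R = 0` the steps are zero and the
slope bound alone shows that the initial iterate is optimal.
-/

/-! ### Weak gradients -/

section WeakGradient

variable {d : ℕ} {Ω : Set (EuclideanSpace ℝ (Fin d))}
  {f g : EuclideanSpace ℝ (Fin d) → ℝ}
  {F G : EuclideanSpace ℝ (Fin d) → EuclideanSpace ℝ (Fin d)}

theorem integrableOn_mul_of_contDiff_of_hasCompactSupport (hf : IntegrableOn f Ω)
    {φ : EuclideanSpace ℝ (Fin d) → ℝ} (hφ : Continuous φ) (hc : HasCompactSupport φ) :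
    IntegrableOn (fun x => f x * φ x) Ω := by
  obtain ⟨C, hC⟩ := hc.exists_bound_of_continuous hφ
  exact Integrable.mul_bdd (c := C) hf hφ.aestronglyMeasurable (ae_of_all _ hC)

theorem integrableOn_smul_of_memLp_two (hΩ : IsCompact Ω) (hG : MemLp G 2 (volume.restrict Ω))
    {φ : EuclideanSpace ℝ (Fin d) → ℝ} (hφ : Continuous φ) (hc : HasCompactSupport φ) :
    IntegrableOn (fun x => φ x • G x) Ω := by
  have : IsFiniteMeasure (volume.restrict Ω) := ⟨by simpa using hΩ.measure_lt_top⟩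
  obtain ⟨C, hC⟩ := hc.exists_bound_of_continuous hφ
  exact Integrable.bdd_smul (hG.integrable (by norm_num)) C hφ.aestronglyMeasurable
    (ae_of_all _ hC)

theorem integrableOn_mul_inner_of_memLp_two (hΩ : IsCompact Ω)
    (hG : MemLp G 2 (volume.restrict Ω))
    {φ : EuclideanSpace ℝ (Fin d) → ℝ} (hφ : Continuous φ) (hc : HasCompactSupport φ)
    (v : EuclideanSpace ℝ (Fin d)) :
    IntegrableOn (fun x => φ x * inner ℝ (G x) v) Ω := by
  have := (integrableOn_smul_of_memLp_two hΩ hG hφ hc).inner_const (𝕜 := ℝ) v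
  simpa only [IntegrableOn, real_inner_smul_left] using this

theorem IsWeakGrad.add (hΩ : IsCompact Ω) (hf : IsWeakGrad Ω f F) (hg : IsWeakGrad Ω g G) :
    IsWeakGrad Ω (f + g) (F + G) := by
  refine ⟨hf.1.add hg.1, hf.2.1.add hg.2.1, fun φ hφ hc hs v => ?_⟩
  have hφ' : Continuous fun x => fderiv ℝ φ x v :=
    (hφ.continuous_fderiv (by simp)).clm_apply continuous_const
  have hc' : HasCompactSupport fun x => fderiv ℝ φ x v := hc.fderiv_apply ℝ v
  simp only [Pi.add_apply, add_mul, inner_add_left, mul_add]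
  rw [integral_add (integrableOn_mul_of_contDiff_of_hasCompactSupport hf.1 hφ' hc')
      (integrableOn_mul_of_contDiff_of_hasCompactSupport hg.1 hφ' hc'),
    integral_add (integrableOn_mul_inner_of_memLp_two hΩ hf.2.1 hφ.continuous hc v)
      (integrableOn_mul_inner_of_memLp_two hΩ hg.2.1 hφ.continuous hc v),
    hf.2.2 φ hφ hc hs v, hg.2.2 φ hφ hc hs v, neg_add]

theorem IsWeakGrad.const_smul (c : ℝ) (hf : IsWeakGrad Ω f F) :
    IsWeakGrad Ω (c • f) (c • F) := by
  refine ⟨hf.1.smul c, hf.2.1.const_smul c, fun φ hφ hc hs v => ?_⟩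
  simp only [Pi.smul_apply, smul_eq_mul, real_inner_smul_left, mul_assoc, mul_left_comm _ c,
    integral_const_mul]
  rw [hf.2.2 φ hφ hc hs v, mul_neg]

theorem IsWeakGrad.congr (hf : IsWeakGrad Ω f F) (h : f =ᵐ[volume.restrict Ω] g) :
    IsWeakGrad Ω g F := by
  refine ⟨(integrable_congr h).1 hf.1, hf.2.1, fun φ hφ hc hs v => ?_⟩
  rw [← hf.2.2 φ hφ hc hs v]
  refine integral_congr_ae ?_
  filter_upwards [h] with x hx
  rw [hx]

theorem IsWeakGrad.ae_eq (hΩc : IsCompact Ω) (hΩ : Convex ℝ Ω) (hF : IsWeakGrad Ω f F)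
    (hG : IsWeakGrad Ω f G) : F =ᵐ[volume.restrict Ω] G := by
  have : IsFiniteMeasure (volume.restrict Ω) := ⟨by simpa using hΩc.measure_lt_top⟩
  have hint : IntegrableOn (F - G) Ω :=
    (hF.2.1.sub hG.2.1).integrable (by norm_num)
  have key := isOpen_interior (s := Ω) |>.ae_eq_zero_of_integral_contDiff_smul_eq_zero
    (μ := volume) (f := F - G) (hint.mono_set interior_subset).locallyIntegrableOn (by
      intro φ hφ hc hs
      have hout : ∀ x, x ∉ Ω → φ x • (F - G) x = 0 := fun x hx => by
        rw [image_eq_zero_of_notMem_tsupport (fun h => hx (interior_subset (hs h))), zero_smul]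
      rw [← setIntegral_eq_integral_of_forall_compl_eq_zero hout]
      have hi := integrableOn_smul_of_memLp_two hΩc (hF.2.1.sub hG.2.1) hφ.continuous hc
      refine ext_inner_left ℝ fun v => ?_
      rw [← integral_inner hi v, inner_zero_right]
      have e : ∀ x, inner ℝ v (φ x • (F - G) x)
          = φ x * inner ℝ (F x) v - φ x * inner ℝ (G x) v := fun x => by
        rw [real_inner_comm, real_inner_smul_left, Pi.sub_apply, inner_sub_left, mul_sub]
      simp only [e]
      rw [integral_sub (integrableOn_mul_inner_of_memLp_two hΩc hF.2.1 hφ.continuous hc v)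
        (integrableOn_mul_inner_of_memLp_two hΩc hG.2.1 hφ.continuous hc v)]
      have h1 := hF.2.2 φ hφ hc hs v
      have h2 := hG.2.2 φ hφ hc hs v
      linarith)
  have hfr : ∀ᵐ x, x ∉ frontier Ω := measure_eq_zero_iff_ae_notMem.1 (hΩ.addHaar_frontier volume)
  rw [Filter.EventuallyEq, ae_restrict_iff' hΩc.measurableSet]
  filter_upwards [key, hfr] with x hx hx' hxΩ
  rw [hΩc.isClosed.frontier_eq] at hx'
  exact sub_eq_zero.1 (hx (by_contra fun h => hx' ⟨hxΩ, h⟩))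

theorem measurable_gradient (h : EuclideanSpace ℝ (Fin d) → ℝ) : Measurable (gradient h) :=
  (InnerProductSpace.toDual ℝ (EuclideanSpace ℝ (Fin d))).symm.continuous.measurable.comp
    (measurable_fderiv ℝ h)

/-- A Lipschitz function is differentiable almost everywhere, and integration by parts holds
for its pointwise gradient. -/
theorem LipschitzWith.isWeakGrad_gradient (hΩ : IsCompact Ω) {K : ℝ≥0} (hf : LipschitzWith K f) :
    IsWeakGrad Ω f (gradient f) := by
  have : IsFiniteMeasure (volume.restrict Ω) := ⟨by simpa using hΩ.measure_lt_top⟩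
  refine ⟨hf.continuous.continuousOn.integrableOn_compact hΩ,
    MemLp.of_bound (measurable_gradient f).aestronglyMeasurable K (ae_of_all _ fun x => ?_),
    fun φ hφ hc hs v => ?_⟩
  · rw [gradient, LinearIsometryEquiv.norm_map]
    exact norm_fderiv_le_of_lipschitz ℝ hf
  · obtain ⟨D, hD⟩ := hφ.lipschitzWith_of_hasCompactSupport hc (by simp)
    have h1 : ∀ x, x ∉ Ω → f x * fderiv ℝ φ x v = 0 := fun x hx => by
      rw [image_eq_zero_of_notMem_tsupport (f := fderiv ℝ φ)
        (fun h => hx (interior_subset (hs (tsupport_fderiv_subset ℝ h))))]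
      simp
    have h2 : ∀ x, x ∉ Ω → φ x * inner ℝ (gradient f x) v = 0 := fun x hx => by
      rw [image_eq_zero_of_notMem_tsupport (fun h => hx (interior_subset (hs h))), zero_mul]
    rw [setIntegral_eq_integral_of_forall_compl_eq_zero h1,
      setIntegral_eq_integral_of_forall_compl_eq_zero h2]
    have h3 := LipschitzWith.integral_lineDeriv_mul_eq (μ := volume) hf hD hc v
    have h4 : ∫ x, φ x * inner ℝ (gradient f x) v = ∫ x, lineDeriv ℝ f x v * φ x := by
      refine integral_congr_ae ?_
      filter_upwards [hf.ae_differentiableAt] with x hx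
      rw [hx.lineDeriv_eq_fderiv, gradient, InnerProductSpace.toDual_symm_apply, mul_comm]
    rw [h4, h3, ← integral_neg]
    refine integral_congr_ae (ae_of_all _ fun x => ?_)
    simp only [(hφ.differentiable (by simp)).differentiableAt.lineDeriv_eq_fderiv, map_neg]
    ring

theorem isWeakGrad_const (hΩ : IsCompact Ω) (c : ℝ) : IsWeakGrad Ω (fun _ => c) 0 := by
  have h := (LipschitzWith.const (α := EuclideanSpace ℝ (Fin d)) c).isWeakGrad_gradient hΩ
  have e : gradient (fun _ : EuclideanSpace ℝ (Fin d) => c) = 0 := by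
    ext1 x
    simp [gradient]
  rwa [e] at h

theorem HasWeakGrad.isWeakGrad (hf : HasWeakGrad Ω f) : IsWeakGrad Ω f (weakGrad Ω f) := by
  rw [weakGrad, dif_pos hf]
  exact hf.choose_spec

theorem HasWeakGrad.add (hΩ : IsCompact Ω) (hf : HasWeakGrad Ω f) (hg : HasWeakGrad Ω g) :
    HasWeakGrad Ω (f + g) := ⟨_, hf.isWeakGrad.add hΩ hg.isWeakGrad⟩

theorem HasWeakGrad.const_smul (c : ℝ) (hf : HasWeakGrad Ω f) : HasWeakGrad Ω (c • f) :=
  ⟨_, hf.isWeakGrad.const_smul c⟩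

theorem HasWeakGrad.sub (hΩ : IsCompact Ω) (hf : HasWeakGrad Ω f) (hg : HasWeakGrad Ω g) :
    HasWeakGrad Ω (f - g) := by
  have := hf.add hΩ (hg.const_smul (-1))
  rwa [neg_one_smul, ← sub_eq_add_neg] at this

theorem HasWeakGrad.congr (hf : HasWeakGrad Ω f) (h : f =ᵐ[volume.restrict Ω] g) :
    HasWeakGrad Ω g := ⟨_, hf.isWeakGrad.congr h⟩

/-- A Lipschitz function on `Ω` extends to a Lipschitz function on the whole space. -/
theorem LipschitzOnWith.hasWeakGrad (hΩ : IsCompact Ω) {K : ℝ≥0} (hf : LipschitzOnWith K f Ω) :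
    HasWeakGrad Ω f := by
  obtain ⟨g, hg, hfg⟩ := hf.extend_real
  refine HasWeakGrad.congr ⟨_, hg.isWeakGrad_gradient hΩ⟩ ?_
  filter_upwards [ae_restrict_mem hΩ.measurableSet] with x hx
  exact (hfg hx).symm

theorem memLp_weakGrad (Ω : Set (EuclideanSpace ℝ (Fin d))) (f : EuclideanSpace ℝ (Fin d) → ℝ) :
    MemLp (weakGrad Ω f) 2 (volume.restrict Ω) := by
  by_cases h : HasWeakGrad Ω f
  · exact h.isWeakGrad.2.1
  · rw [weakGrad, dif_neg h]
    exact MemLp.zero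

/-- The weak gradient as an element of the Hilbert space `L²(Ω; ℝᵈ)`, where it is unique. -/
noncomputable def weakGradLp (Ω : Set (EuclideanSpace ℝ (Fin d)))
    (f : EuclideanSpace ℝ (Fin d) → ℝ) :
    Lp (EuclideanSpace ℝ (Fin d)) 2 (volume.restrict Ω) :=
  (memLp_weakGrad Ω f).toLp

theorem IsWeakGrad.weakGradLp_eq (hΩc : IsCompact Ω) (hΩ : Convex ℝ Ω) (hf : IsWeakGrad Ω f F) :
    weakGradLp Ω f = hf.2.1.toLp :=
  MemLp.toLp_congr _ _ ((HasWeakGrad.isWeakGrad ⟨F, hf⟩).ae_eq hΩc hΩ hf)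

theorem weakGradLp_add (hΩc : IsCompact Ω) (hΩ : Convex ℝ Ω) (hf : HasWeakGrad Ω f)
    (hg : HasWeakGrad Ω g) : weakGradLp Ω (f + g) = weakGradLp Ω f + weakGradLp Ω g := by
  rw [(hf.isWeakGrad.add hΩc hg.isWeakGrad).weakGradLp_eq hΩc hΩ]
  exact MemLp.toLp_add _ _

theorem weakGradLp_const_smul (hΩc : IsCompact Ω) (hΩ : Convex ℝ Ω) (c : ℝ)
    (hf : HasWeakGrad Ω f) : weakGradLp Ω (c • f) = c • weakGradLp Ω f := by
  rw [(hf.isWeakGrad.const_smul c).weakGradLp_eq hΩc hΩ]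
  exact MemLp.toLp_const_smul _ _

theorem weakGradLp_sub (hΩc : IsCompact Ω) (hΩ : Convex ℝ Ω) (hf : HasWeakGrad Ω f)
    (hg : HasWeakGrad Ω g) : weakGradLp Ω (f - g) = weakGradLp Ω f - weakGradLp Ω g := by
  have := weakGradLp_add hΩc hΩ hf (hg.const_smul (-1))
  rwa [weakGradLp_const_smul hΩc hΩ _ hg, neg_one_smul, neg_one_smul, ← sub_eq_add_neg,
    ← sub_eq_add_neg] at this

theorem weakGradLp_congr (hΩc : IsCompact Ω) (hΩ : Convex ℝ Ω) (hf : HasWeakGrad Ω f)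
    (h : f =ᵐ[volume.restrict Ω] g) : weakGradLp Ω g = weakGradLp Ω f :=
  (hf.isWeakGrad.congr h).weakGradLp_eq hΩc hΩ

theorem weakGradLp_const (hΩc : IsCompact Ω) (hΩ : Convex ℝ Ω) (c : ℝ) :
    weakGradLp Ω (fun _ => c) = 0 := by
  rw [(isWeakGrad_const hΩc c).weakGradLp_eq hΩc hΩ]
  exact MemLp.toLp_zero _

theorem hdotInner_eq_inner (f g : EuclideanSpace ℝ (Fin d) → ℝ) :
    hdotInner Ω f g = inner ℝ (weakGradLp Ω f) (weakGradLp Ω g) := by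
  rw [L2.inner_def]
  refine integral_congr_ae ?_
  filter_upwards [(memLp_weakGrad Ω f).coeFn_toLp, (memLp_weakGrad Ω g).coeFn_toLp] with x h1 h2
  rw [weakGradLp, weakGradLp, h1, h2]

theorem hdotNorm_eq_norm (f : EuclideanSpace ℝ (Fin d) → ℝ) :
    hdotNorm Ω f = ‖weakGradLp Ω f‖ := by
  rw [hdotNorm, hdotInner_eq_inner, real_inner_self_eq_norm_sq, Real.sqrt_sq (norm_nonneg _)]

/-- Subtracting the mean brings a function with a weak gradient into the homogeneous space. -/
theorem HasWeakGrad.exists_memHdot_sub_const (hΩc : IsCompact Ω) (hΩ : Convex ℝ Ω)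
    (hf : HasWeakGrad Ω f) :
    ∃ c : ℝ, MemHdot Ω (f - fun _ => c) ∧
      weakGradLp Ω (f - fun _ => c) = weakGradLp Ω f := by
  have : IsFiniteMeasure (volume.restrict Ω) := ⟨by simpa using hΩc.measure_lt_top⟩
  have hc : ∀ c : ℝ, HasWeakGrad Ω fun _ => c := fun c => ⟨_, isWeakGrad_const hΩc c⟩
  refine ⟨⨍ x in Ω, f x, ⟨hf.sub hΩc (hc _), ?_⟩, ?_⟩
  · exact integral_sub_average _ _
  · rw [weakGradLp_sub hΩc hΩ hf (hc _), weakGradLp_const hΩc hΩ, sub_zero]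

end WeakGradient

/-! ### The `c`-transform and its transport map -/

section CTransform

variable {d : ℕ} {Ω : Set (EuclideanSpace ℝ (Fin d))} {f : EuclideanSpace ℝ (Fin d) → ℝ}

theorem bddBelow_range_cost_sub (hf : BddAbove (f '' Ω)) (x : EuclideanSpace ℝ (Fin d)) :
    BddBelow (range fun y : Ω => ‖x - (y : EuclideanSpace ℝ (Fin d))‖ ^ 2 / 2 - f y) := by
  obtain ⟨C, hC⟩ := hf
  refine ⟨-C, ?_⟩
  rintro _ ⟨y, rfl⟩
  have h1 : f y ≤ C := hC ⟨y, y.2, rfl⟩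
  have h2 : 0 ≤ ‖x - (y : EuclideanSpace ℝ (Fin d))‖ ^ 2 / 2 := by positivity
  dsimp only
  linarith

theorem cTransform_le (hf : BddAbove (f '' Ω)) (x : EuclideanSpace ℝ (Fin d))
    {y : EuclideanSpace ℝ (Fin d)} (hy : y ∈ Ω) : cTransform Ω f x ≤ ‖x - y‖ ^ 2 / 2 - f y :=
  ciInf_le (bddBelow_range_cost_sub hf x) (⟨y, hy⟩ : Ω)

/-- On a ball containing `Ω`, a `c`-transform is an infimum of functions that are Lipschitz with
a common constant. -/
theorem lipschitzOnWith_cTransform (hne : Ω.Nonempty) (hf : BddAbove (f '' Ω)) {r : ℝ≥0}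
    (hr : Ω ⊆ Metric.ball 0 r) :
    LipschitzOnWith (2 * r) (cTransform Ω f) (Metric.ball 0 r) := by
  have : Nonempty Ω := hne.to_subtype
  refine LipschitzOnWith.of_le_add_mul _ fun x hx x' hx' => ?_
  rw [← sub_le_iff_le_add]
  refine le_ciInf fun y => ?_
  have h1 := cTransform_le hf x y.2
  have h2 := mem_ball_zero_iff.1 hx
  have h3 := mem_ball_zero_iff.1 hx'
  have h4 := mem_ball_zero_iff.1 (hr y.2)
  generalize (y : EuclideanSpace ℝ (Fin d)) = z at *
  have h5 : ‖x - z‖ ≤ dist x x' + ‖x' - z‖ := by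
    rw [dist_eq_norm]
    exact norm_sub_le_norm_sub_add_norm_sub x x' z
  have h6 : ‖x - z‖ ≤ 2 * r := (norm_sub_le _ _).trans (by linarith)
  have h7 : ‖x' - z‖ ≤ 2 * r := (norm_sub_le _ _).trans (by linarith)
  have h8 : 0 ≤ dist x x' := dist_nonneg
  have h9 : 0 ≤ ‖x - z‖ := norm_nonneg _
  have h10 : 0 ≤ ‖x' - z‖ := norm_nonneg _
  push_cast
  nlinarith [mul_le_mul_of_nonneg_right h5 (add_nonneg h9 h10),
    mul_le_mul_of_nonneg_left (add_le_add h6 h7) h8]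

theorem exists_subset_ball_zero (hΩ : IsCompact Ω) : ∃ r : ℝ≥0, Ω ⊆ Metric.ball 0 r := by
  obtain ⟨r, hr⟩ := hΩ.isBounded.subset_ball 0
  exact ⟨r.toNNReal, hr.trans (Metric.ball_subset_ball (Real.le_coe_toNNReal r))⟩

theorem exists_lipschitzOnWith_cTransform (hΩ : IsCompact Ω) (hne : Ω.Nonempty)
    (hf : BddAbove (f '' Ω)) : ∃ K, LipschitzOnWith K (cTransform Ω f) Ω := by
  obtain ⟨r, hr⟩ := exists_subset_ball_zero hΩ
  exact ⟨_, (lipschitzOnWith_cTransform hne hf hr).mono hr⟩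

theorem IsCConcave.exists_lipschitzOnWith (hΩ : IsCompact Ω) (hne : Ω.Nonempty)
    (hf : IsCConcave Ω f) : ∃ K, LipschitzOnWith K f Ω := by
  obtain ⟨g, hg, hfg⟩ := hf
  obtain ⟨K, hK⟩ := exists_lipschitzOnWith_cTransform hΩ hne hg
  exact ⟨K, fun x hx y hy => by rw [hfg x hx, hfg y hy]; exact hK hx hy⟩

theorem exists_cTransform_eq (hΩ : IsCompact Ω) (hne : Ω.Nonempty) (hf : ContinuousOn f Ω)
    (x : EuclideanSpace ℝ (Fin d)) :
    ∃ y ∈ Ω, cTransform Ω f x = ‖x - y‖ ^ 2 / 2 - f y := by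
  have : Nonempty Ω := hne.to_subtype
  have hc : ContinuousOn (fun y => ‖x - y‖ ^ 2 / 2 - f y) Ω :=
    (Continuous.continuousOn (by fun_prop)).sub hf
  obtain ⟨y, hy, hmin⟩ := hΩ.exists_isMinOn hne hc
  exact ⟨y, hy, (cTransform_le (hΩ.bddAbove_image hf) x hy).antisymm
    (le_ciInf fun z => hmin z.2)⟩

/-- First order optimality: if `y` attains the infimum defining `f^c (x)`, then `‖· - y‖² / 2 - f^c`
is minimal at `x`, so `∇f^c (x) = x - y`. -/
theorem transportMap_cTransform_eq (hf : BddAbove (f '' Ω)) {x y : EuclideanSpace ℝ (Fin d)}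
    (hy : y ∈ Ω) (hxy : cTransform Ω f x = ‖x - y‖ ^ 2 / 2 - f y)
    (hd : DifferentiableAt ℝ (cTransform Ω f) x) : transportMap (cTransform Ω f) x = y := by
  have h1 : HasFDerivAt (fun z => ‖z - y‖ ^ 2 - 2 * cTransform Ω f z)
      (2 • (innerSL ℝ (x - y)).comp (ContinuousLinearMap.id ℝ _)
        - (2 : ℝ) • fderiv ℝ (cTransform Ω f) x) x :=
    ((hasFDerivAt_id x).sub_const y).norm_sq.sub (hd.hasFDerivAt.const_mul 2)
  have hmin : IsLocalMin (fun z => ‖z - y‖ ^ 2 - 2 * cTransform Ω f z) x :=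
    Filter.Eventually.of_forall fun z => by
      have := cTransform_le hf z hy
      dsimp only
      linarith
  have h2 := hmin.hasFDerivAt_eq_zero h1
  have h3 : gradient (cTransform Ω f) x = x - y := by
    refine ext_inner_right ℝ fun v => ?_
    rw [gradient, InnerProductSpace.toDual_symm_apply]
    have h4 := congrArg (fun L => L v) h2
    simp at h4
    linarith [inner_sub_left (𝕜 := ℝ) x y v]
  rw [transportMap, h3, sub_sub_cancel]

/-- At almost every point of `Ω` the transport map of `f^c` selects a minimizer: `f^c` is locally
Lipschitz, hence almost everywhere differentiable. -/
theorem ae_transportMap_mem (hΩ : IsCompact Ω) (hf : ContinuousOn f Ω) :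
    ∀ᵐ x, x ∈ Ω → transportMap (cTransform Ω f) x ∈ Ω ∧
      cTransform Ω f x = ‖x - transportMap (cTransform Ω f) x‖ ^ 2 / 2
        - f (transportMap (cTransform Ω f) x) := by
  rcases Ω.eq_empty_or_nonempty with rfl | hne
  · simp
  have hb := hΩ.bddAbove_image hf
  obtain ⟨r, hr⟩ := exists_subset_ball_zero hΩ
  filter_upwards [(lipschitzOnWith_cTransform hne hb hr).ae_differentiableWithinAt_of_mem
    (μ := volume)] with x hx hxΩ
  obtain ⟨y, hy, hxy⟩ := exists_cTransform_eq hΩ hne hf x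
  rw [transportMap_cTransform_eq hb hy hxy
    ((hx (hr hxΩ)).differentiableAt (Metric.isOpen_ball.mem_nhds (hr hxΩ)))]
  exact ⟨hy, hxy⟩

theorem measurable_transportMap (h : EuclideanSpace ℝ (Fin d) → ℝ) :
    Measurable (transportMap h) :=
  measurable_id.sub (measurable_gradient h)

end CTransform

section Pushforward

variable {d : ℕ} {Ω : Set (EuclideanSpace ℝ (Fin d))} {f g h : EuclideanSpace ℝ (Fin d) → ℝ}
  {μ : Measure (EuclideanSpace ℝ (Fin d))}

theorem ae_transportMap_mem_of_absolutelyContinuous (hΩ : IsCompact Ω) (hμΩ : μ Ωᶜ = 0)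
    (hμ : μ ≪ volume) (hf : ContinuousOn f Ω) :
    ∀ᵐ x ∂μ, x ∈ Ω ∧ transportMap (cTransform Ω f) x ∈ Ω ∧
      cTransform Ω f x = ‖x - transportMap (cTransform Ω f) x‖ ^ 2 / 2
        - f (transportMap (cTransform Ω f) x) := by
  filter_upwards [hμ.ae_le (ae_transportMap_mem hΩ hf), mem_ae_iff.2 hμΩ] with x hx hxΩ
  exact ⟨hxΩ, hx hxΩ⟩

theorem map_transportMap_compl (hΩ : IsCompact Ω) (hμΩ : μ Ωᶜ = 0)
    (hμ : μ ≪ volume) (hf : ContinuousOn f Ω) :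
    μ.map (transportMap (cTransform Ω f)) Ωᶜ = 0 := by
  rw [Measure.map_apply (measurable_transportMap _) hΩ.measurableSet.compl]
  refine measure_mono_null (fun x hx => ?_)
    (ae_iff.1 (ae_transportMap_mem_of_absolutelyContinuous hΩ hμΩ hμ hf))
  exact fun hx' => hx hx'.2.1

theorem restrict_eq_self_of_compl_null {ν : Measure (EuclideanSpace ℝ (Fin d))}
    (hν : ν Ωᶜ = 0) : ν.restrict Ω = ν :=
  Measure.restrict_eq_self_of_ae_mem (mem_ae_iff.2 hν)

theorem integral_map_transportMap (hΩ : IsCompact Ω) [IsFiniteMeasure μ] (hμΩ : μ Ωᶜ = 0)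
    (hμ : μ ≪ volume) (hf : ContinuousOn f Ω) (hh : ContinuousOn h Ω) :
    ∫ y in Ω, h y ∂(μ.map (transportMap (cTransform Ω f)))
        = ∫ x in Ω, h (transportMap (cTransform Ω f) x) ∂μ ∧
      IntegrableOn (fun x => h (transportMap (cTransform Ω f) x)) Ω μ := by
  have hm := measurable_transportMap (cTransform Ω f)
  have hr := restrict_eq_self_of_compl_null (map_transportMap_compl hΩ hμΩ hμ hf)
  have hi : IntegrableOn h Ω (μ.map (transportMap (cTransform Ω f))) :=
    hh.integrableOn_compact hΩ
  rw [IntegrableOn, hr] at hi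
  rw [IntegrableOn, hr, restrict_eq_self_of_compl_null hμΩ]
  exact ⟨integral_map hm.aemeasurable hi.aestronglyMeasurable,
    (integrable_map_measure hi.aestronglyMeasurable hm.aemeasurable).1 hi⟩

/-- The supergradient inequality for `f ↦ ∫ f^c dμ`, obtained by testing the infimum that defines
`g^c (x)` with the minimizer for `f^c (x)`. -/
theorem integral_cTransform_le (hΩ : IsCompact Ω) [IsFiniteMeasure μ] (hμΩ : μ Ωᶜ = 0)
    (hμ : μ ≪ volume) (hf : ContinuousOn f Ω) (hg : ContinuousOn g Ω) :
    ∫ x in Ω, cTransform Ω g x ∂μ ≤ ∫ x in Ω, cTransform Ω f x ∂μ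
      - ∫ y in Ω, (g - f) y ∂(μ.map (transportMap (cTransform Ω f))) := by
  rcases Ω.eq_empty_or_nonempty with rfl | hne
  · simp
  have hint : ∀ {k : EuclideanSpace ℝ (Fin d) → ℝ}, ContinuousOn k Ω →
      IntegrableOn (cTransform Ω k) Ω μ := fun hk => by
    obtain ⟨K, hK⟩ := exists_lipschitzOnWith_cTransform hΩ hne (hΩ.bddAbove_image hk)
    exact hK.continuousOn.integrableOn_compact hΩ
  obtain ⟨h1, h2⟩ := integral_map_transportMap hΩ hμΩ hμ hf (hg.sub hf)
  rw [h1, ← integral_sub (hint hf) h2]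
  refine integral_mono_ae (hint hg) ((hint hf).sub h2) (ae_restrict_of_ae ?_)
  filter_upwards [ae_transportMap_mem_of_absolutelyContinuous hΩ hμΩ hμ hf] with x hx
  have := cTransform_le (hΩ.bddAbove_image hg) x hx.2.1
  simp only [Pi.sub_apply]
  linarith [hx.2.2]

end Pushforward

/-! ### Supergradients of the dual functional -/

section DualFunctional

variable {d n : ℕ} {Ω : Set (EuclideanSpace ℝ (Fin d))} {α : Fin (n + 1) → ℝ}
  {μ : Fin (n + 1) → Measure (EuclideanSpace ℝ (Fin d))}
  {f f' : Fin n → EuclideanSpace ℝ (Fin d) → ℝ} {i : Fin n} {h g : EuclideanSpace ℝ (Fin d) → ℝ}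

/-- The `i`-th partial supergradient of `𝒟` at `f`, as a linear functional of the direction `h`:
`α_i (∫ h d(T_{f_mix^c})_# μ_m - ∫ h d(T_{f_i^c})_# μ_i)`. -/
noncomputable def dualSlope (Ω : Set (EuclideanSpace ℝ (Fin d))) (α : Fin (n + 1) → ℝ)
    (μ : Fin (n + 1) → Measure (EuclideanSpace ℝ (Fin d)))
    (f : Fin n → EuclideanSpace ℝ (Fin d) → ℝ) (i : Fin n)
    (h : EuclideanSpace ℝ (Fin d) → ℝ) : ℝ :=
  α i.castSucc *
    ((∫ y in Ω, h y ∂((μ (Fin.last n)).map (transportMap (cTransform Ω (fMix α f)))))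
      - ∫ y in Ω, h y ∂((μ i.castSucc).map (transportMap (cTransform Ω (f i)))))

theorem dualSlope_const_smul (c : ℝ) :
    dualSlope Ω α μ f i (c • h) = c * dualSlope Ω α μ f i h := by
  simp only [dualSlope, Pi.smul_apply, smul_eq_mul, integral_const_mul]
  ring

theorem continuousOn_fMix (hf : ∀ i, ContinuousOn (f i) Ω) : ContinuousOn (fMix α f) Ω :=
  (continuousOn_finsetSum _ fun i _ => continuousOn_const.mul (hf i)).neg

/-- The two pushforward measures have the same mass, so constants do not contribute. -/
theorem dualSlope_sub_const (hΩ : IsCompact Ω) (hμ : ∀ i, IsProbabilityMeasure (μ i))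
    (hμΩ : ∀ i, μ i Ωᶜ = 0) (hμac : ∀ i, μ i ≪ volume) (hf : ∀ i, ContinuousOn (f i) Ω)
    (hh : ContinuousOn h Ω) (c : ℝ) :
    dualSlope Ω α μ f i (h - fun _ => c) = dualSlope Ω α μ f i h := by
  have key : ∀ (j : Fin (n + 1)) {k : EuclideanSpace ℝ (Fin d) → ℝ}, ContinuousOn k Ω →
      ∫ y in Ω, (h y - c) ∂((μ j).map (transportMap (cTransform Ω k)))
        = (∫ y in Ω, h y ∂((μ j).map (transportMap (cTransform Ω k)))) - c := by
    intro j k hk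
    have : IsProbabilityMeasure ((μ j).map (transportMap (cTransform Ω k))) :=
      Measure.isProbabilityMeasure_map (measurable_transportMap _).aemeasurable
    rw [integral_sub (hh.integrableOn_compact hΩ) (integrableOn_const (by finiteness)),
      restrict_eq_self_of_compl_null (map_transportMap_compl hΩ (hμΩ j) (hμac j) hk)]
    simp
  simp only [dualSlope, Pi.sub_apply, key _ (hf i), key _ (continuousOn_fMix hf)]
  ring

/-- The supergradient inequality for `𝒟`, jointly in all arguments. -/
theorem dualD_le_add_sum_dualSlope (hΩ : IsCompact Ω) (hα : ∀ i, 0 < α i)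
    (hμ : ∀ i, IsProbabilityMeasure (μ i)) (hμΩ : ∀ i, μ i Ωᶜ = 0) (hμac : ∀ i, μ i ≪ volume)
    (hf : ∀ i, ContinuousOn (f i) Ω) (hf' : ∀ i, ContinuousOn (f' i) Ω) :
    dualD Ω α μ f' ≤ dualD Ω α μ f + ∑ i, dualSlope Ω α μ f i (f' i - f i) := by
  have h1 := fun i : Fin n => mul_le_mul_of_nonneg_left
    (integral_cTransform_le hΩ (hμΩ i.castSucc) (hμac _) (hf i) (hf' i)) (hα i.castSucc).le
  have h2 := mul_le_mul_of_nonneg_left (integral_cTransform_le hΩ (hμΩ (Fin.last n)) (hμac _)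
    (continuousOn_fMix (α := α) hf) (continuousOn_fMix (α := α) hf')) (hα (Fin.last n)).le
  set ν := (μ (Fin.last n)).map (transportMap (cTransform Ω (fMix α f)))
  have h3 : α (Fin.last n) * ∫ y in Ω, (fMix α f' - fMix α f) y ∂ν
      = -∑ i : Fin n, α i.castSucc * ∫ y in Ω, (f' i - f i) y ∂ν := by
    have e : ∀ y, (fMix α f' - fMix α f) y
        = -∑ i : Fin n, α i.castSucc / α (Fin.last n) * (f' i - f i) y := fun y => by
      simp only [Pi.sub_apply, fMix, mul_sub, Finset.sum_sub_distrib]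
      ring
    simp only [e]
    rw [integral_neg, integral_finsetSum _ fun i _ =>
      (((hf' i).sub (hf i)).integrableOn_compact hΩ).const_mul _, mul_neg, Finset.mul_sum]
    congr 1
    refine Finset.sum_congr rfl fun i _ => ?_
    rw [integral_const_mul, ← mul_assoc, mul_div_cancel₀ _ (hα _).ne']
  have h4 := Finset.sum_le_sum fun i (_ : i ∈ Finset.univ) => h1 i
  simp only [mul_sub, Finset.sum_sub_distrib] at h2 h4
  simp only [dualD, dualSlope, mul_sub, Finset.sum_sub_distrib]
  linarith

/-- The Sobolev gradient represents `dualSlope`: along a line, `𝒟` lies below the affine function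
with that slope and touches it at the base point, so the slope is the derivative. -/
theorem IsSobolevGradient.hdotInner_eq (hΩc : IsCompact Ω) (hΩ : Convex ℝ Ω)
    (hα : ∀ i, 0 < α i) (hμ : ∀ i, IsProbabilityMeasure (μ i)) (hμΩ : ∀ i, μ i Ωᶜ = 0)
    (hμac : ∀ i, μ i ≪ volume) (hf : ∀ i, ContinuousOn (f i) Ω)
    (hg : IsSobolevGradient Ω α μ f i g) (hh : HasWeakGrad Ω h) (hhc : ContinuousOn h Ω) :
    hdotInner Ω g h = dualSlope Ω α μ f i h := by
  obtain ⟨c, hc, hch⟩ := hh.exists_memHdot_sub_const hΩc hΩ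
  rw [← dualSlope_sub_const hΩc hμ hμΩ hμac hf hhc c, hdotInner_eq_inner, ← hch,
    ← hdotInner_eq_inner]
  have hkc : ContinuousOn (h - fun _ => c) Ω := hhc.sub continuousOn_const
  generalize h - (fun _ => c) = k at *
  have hd := (hg.2 k hc hkc).sub ((hasDerivAt_id (0 : ℝ)).mul_const (dualSlope Ω α μ f i k))
  have hle : ∀ ε : ℝ, dualD Ω α μ (Function.update f i (f i + ε • k))
      ≤ dualD Ω α μ f + ε * dualSlope Ω α μ f i k := fun ε => by
    have hcont : ∀ j, ContinuousOn (Function.update f i (f i + ε • k) j) Ω := fun j => by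
      rcases eq_or_ne j i with rfl | hj
      · rw [Function.update_self]
        exact (hf j).add (hkc.const_smul ε)
      · rw [Function.update_of_ne hj]
        exact hf j
    refine (dualD_le_add_sum_dualSlope hΩc hα hμ hμΩ hμac hf hcont).trans_eq ?_
    rw [Finset.sum_eq_single i, Function.update_self, add_sub_cancel_left, dualSlope_const_smul]
    · intro j _ hj
      rw [Function.update_of_ne hj, sub_self]
      simp [dualSlope]
    · simp
  have hmax : IsLocalMax (fun ε : ℝ => dualD Ω α μ (Function.update f i (f i + ε • k))
      - id ε * dualSlope Ω α μ f i k) 0 := Filter.Eventually.of_forall fun ε => by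
    have := hle ε
    simp only [zero_smul, add_zero, Function.update_eq_self, id]
    linarith
  have := hmax.hasDerivAt_eq_zero hd
  linarith

end DualFunctional

/-! ### Slopes and the dual Sobolev norm -/

section DualNorm

variable {d n : ℕ} {Ω : Set (EuclideanSpace ℝ (Fin d))} {α : Fin (n + 1) → ℝ}
  {μ : Fin (n + 1) → Measure (EuclideanSpace ℝ (Fin d))}
  {f f' : Fin n → EuclideanSpace ℝ (Fin d) → ℝ} {i : Fin n} {h g : EuclideanSpace ℝ (Fin d) → ℝ}

/-- The `i`-th summand of `pushforwardGap` as a real number, `0` if it is infinite. -/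
noncomputable def partialGap (Ω : Set (EuclideanSpace ℝ (Fin d))) (α : Fin (n + 1) → ℝ)
    (μ : Fin (n + 1) → Measure (EuclideanSpace ℝ (Fin d)))
    (f : Fin n → EuclideanSpace ℝ (Fin d) → ℝ) (i : Fin n) : ℝ :=
  (ENNReal.ofReal (α i.castSucc) *
    hdotNegNorm Ω ((μ i.castSucc).map (transportMap (cTransform Ω (f i))))
      ((μ (Fin.last n)).map (transportMap (cTransform Ω (fMix α f))))).toReal

theorem sum_toReal_sq_le_of_rpow_le {ι : Type*} [Fintype ι] {b : ι → ℝ≥0∞} {M : ℝ≥0}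
    (hM : (∑ i, b i ^ 2) ^ (1 / 2 : ℝ) ≤ M) :
    (∀ i, b i ≠ ⊤) ∧ ∑ i, (b i).toReal ^ 2 ≤ (M : ℝ) ^ 2 := by
  have h1 : ∑ i, b i ^ 2 ≤ (M : ℝ≥0∞) ^ 2 := by
    have := ENNReal.rpow_le_rpow hM (zero_le_two (α := ℝ))
    rw [← ENNReal.rpow_mul] at this
    norm_num at this
    exact this
  have hfin : ∀ i, b i ≠ ⊤ := fun i hi => by
    have h2 := (Finset.single_le_sum (f := fun i => b i ^ 2) (fun _ _ => zero_le)
      (Finset.mem_univ i)).trans h1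
    rw [hi] at h2
    simp at h2
  refine ⟨hfin, ?_⟩
  have h3 := ENNReal.toReal_mono (by finiteness) h1
  rw [ENNReal.toReal_sum fun i _ => ENNReal.pow_ne_top (hfin i)] at h3
  simpa using h3

theorem sum_sq_le_of_pushforwardGap_le {M : ℝ≥0} (hM : pushforwardGap Ω α μ f ≤ M) :
    (∀ i : Fin n, ENNReal.ofReal (α i.castSucc) *
      hdotNegNorm Ω ((μ i.castSucc).map (transportMap (cTransform Ω (f i))))
        ((μ (Fin.last n)).map (transportMap (cTransform Ω (fMix α f)))) ≠ ⊤) ∧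
      ∑ i, partialGap Ω α μ f i ^ 2 ≤ (M : ℝ) ^ 2 :=
  sum_toReal_sq_le_of_rpow_le hM

theorem neg_dualSlope_le (hα : ∀ i, 0 < α i)
    (hfin : ENNReal.ofReal (α i.castSucc) *
      hdotNegNorm Ω ((μ i.castSucc).map (transportMap (cTransform Ω (f i))))
        ((μ (Fin.last n)).map (transportMap (cTransform Ω (fMix α f)))) ≠ ⊤)
    (hh : MemHdot Ω h) (hhc : ContinuousOn h Ω) (h1 : hdotNorm Ω h ≤ 1) :
    -dualSlope Ω α μ f i h ≤ partialGap Ω α μ f i := by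
  rw [partialGap, ← ENNReal.ofReal_le_iff_le_toReal hfin, dualSlope, ← mul_neg, neg_sub,
    ENNReal.ofReal_mul (hα _).le]
  gcongr
  exact le_iSup₂_of_le h ⟨hh, hhc, h1⟩ le_rfl

theorem abs_dualSlope_le (hΩc : IsCompact Ω) (hΩ : Convex ℝ Ω)
    (hα : ∀ i, 0 < α i) (hμ : ∀ i, IsProbabilityMeasure (μ i)) (hμΩ : ∀ i, μ i Ωᶜ = 0)
    (hμac : ∀ i, μ i ≪ volume) (hf : ∀ i, ContinuousOn (f i) Ω)
    {M : ℝ≥0} (hM : pushforwardGap Ω α μ f ≤ M) (hh : HasWeakGrad Ω h)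
    (hhc : ContinuousOn h Ω) :
    |dualSlope Ω α μ f i h| ≤ partialGap Ω α μ f i * ‖weakGradLp Ω h‖ := by
  obtain ⟨c, hc, hch⟩ := hh.exists_memHdot_sub_const hΩc hΩ
  rw [← dualSlope_sub_const hΩc hμ hμΩ hμac hf hhc c, ← hch]
  have hkc : ContinuousOn (h - fun _ => c) Ω := hhc.sub continuousOn_const
  generalize h - (fun _ => c) = k at *
  have hscale : ∀ s : ℝ, |s| * ‖weakGradLp Ω k‖ ≤ 1 →
      -(s * dualSlope Ω α μ f i k) ≤ partialGap Ω α μ f i := fun s hs => by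
    rw [← dualSlope_const_smul]
    refine neg_dualSlope_le hα ((sum_sq_le_of_pushforwardGap_le hM).1 i)
      ⟨hc.1.const_smul s, ?_⟩ (hkc.const_smul s) ?_
    · simp only [Pi.smul_apply, smul_eq_mul, integral_const_mul, hc.2, mul_zero]
    · rwa [hdotNorm_eq_norm, weakGradLp_const_smul hΩc hΩ s hc.1, norm_smul]
  generalize dualSlope Ω α μ f i k = L at *
  have hb : ∀ s : ℝ, 0 ≤ s → s * ‖weakGradLp Ω k‖ ≤ 1 → s * |L| ≤ partialGap Ω α μ f i := by
    intro s hs hs1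
    rcases abs_cases L with ⟨h1, -⟩ | ⟨h1, -⟩
    · have := hscale (-s) (by rwa [abs_neg, abs_of_nonneg hs])
      rw [h1]
      linarith
    · have := hscale s (by rwa [abs_of_nonneg hs])
      rw [h1]
      linarith
  rcases (norm_nonneg (weakGradLp Ω k)).eq_or_lt with h0 | h0
  · -- A direction of zero norm can be scaled arbitrarily, so its slope vanishes.
    rw [← h0, mul_zero]
    by_contra! hL
    have h2 : 0 ≤ partialGap Ω α μ f i := ENNReal.toReal_nonneg
    have := hb ((partialGap Ω α μ f i + 1) / |L|) (by positivity) (by simp [← h0])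
    rw [div_mul_cancel₀ _ hL.ne'] at this
    linarith
  · have := hb ‖weakGradLp Ω k‖⁻¹ (by positivity) (by rw [inv_mul_cancel₀ h0.ne'])
    rwa [inv_mul_le_iff₀ h0, mul_comm] at this

/-- If the Sobolev gradient has a continuous representative `g`, that representative is itself an
admissible direction, which bounds its norm by the dual norm of the slope. -/
theorem IsSobolevGradient.norm_le (hΩc : IsCompact Ω) (hΩ : Convex ℝ Ω)
    (hα : ∀ i, 0 < α i) (hμ : ∀ i, IsProbabilityMeasure (μ i)) (hμΩ : ∀ i, μ i Ωᶜ = 0)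
    (hμac : ∀ i, μ i ≪ volume) (hf : ∀ i, ContinuousOn (f i) Ω)
    {M : ℝ≥0} (hM : pushforwardGap Ω α μ f ≤ M)
    (hh : IsSobolevGradient Ω α μ f i h) (hhg : h =ᵐ[volume.restrict Ω] g)
    (hgc : ContinuousOn g Ω) :
    ‖weakGradLp Ω h‖ ≤ partialGap Ω α μ f i := by
  have hg := hh.1.1.congr hhg
  have h1 := hh.hdotInner_eq hΩc hΩ hα hμ hμΩ hμac hf hg hgc
  have h2 := (le_abs_self _).trans
    (abs_dualSlope_le (i := i) hΩc hΩ hα hμ hμΩ hμac hf hM hg hgc)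
  rw [← h1, hdotInner_eq_inner, weakGradLp_congr hΩc hΩ hh.1.1 hhg,
    real_inner_self_eq_norm_sq, sq] at h2
  rcases (norm_nonneg (weakGradLp Ω h)).eq_or_lt with h0 | h0
  · rw [← h0]
    exact ENNReal.toReal_nonneg
  · exact le_of_mul_le_mul_right h2 h0

end DualNorm

/-! ### Gradient ascent -/

section Ascent

/-- The telescoped recursion of the subgradient method. -/
theorem two_mul_mul_sum_le_of_recursion {T : ℕ} {E η : ℕ → ℝ} {δ B : ℝ} (hE : ∀ t, 0 ≤ E t)
    (hrec : ∀ t < T, E (t + 1) ≤ E t - 2 * η t * δ + η t ^ 2 * B) :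
    2 * δ * ∑ t ∈ Finset.range T, η t ≤ E 0 + B * ∑ t ∈ Finset.range T, η t ^ 2 := by
  have key : ∀ s ≤ T, E s + 2 * δ * ∑ t ∈ Finset.range s, η t
      ≤ E 0 + B * ∑ t ∈ Finset.range s, η t ^ 2 := by
    intro s
    induction s with
    | zero => simp
    | succ s ih =>
      intro hs
      rw [Finset.sum_range_succ, Finset.sum_range_succ]
      linarith [ih (by omega), hrec s (by omega)]
  linarith [key T le_rfl, hE T]

variable {d n : ℕ} {Ω : Set (EuclideanSpace ℝ (Fin d))} {α : Fin (n + 1) → ℝ}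
  {μ : Fin (n + 1) → Measure (EuclideanSpace ℝ (Fin d))}
  {f f' : Fin n → EuclideanSpace ℝ (Fin d) → ℝ}

theorem hdotDist_sq : hdotDist Ω f f' ^ 2 = ∑ i, ‖weakGradLp Ω (f i - f' i)‖ ^ 2 := by
  rw [hdotDist, Real.sq_sqrt (Finset.sum_nonneg fun i _ => sq_nonneg _)]
  simp only [hdotNorm_eq_norm]

theorem hdotDist_nonneg : 0 ≤ hdotDist Ω f f' := Real.sqrt_nonneg _

theorem dualD_sub_le_mul_hdotDist (hΩc : IsCompact Ω) (hΩ : Convex ℝ Ω)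
    (hα : ∀ i, 0 < α i) (hμ : ∀ i, IsProbabilityMeasure (μ i)) (hμΩ : ∀ i, μ i Ωᶜ = 0)
    (hμac : ∀ i, μ i ≪ volume) (hf : ∀ i, ContinuousOn (f i) Ω)
    (hf' : ∀ i, ContinuousOn (f' i) Ω) (hw : ∀ i, HasWeakGrad Ω (f i))
    (hw' : ∀ i, HasWeakGrad Ω (f' i)) {M : ℝ≥0} (hM : pushforwardGap Ω α μ f ≤ M) :
    dualD Ω α μ f' - dualD Ω α μ f ≤ M * hdotDist Ω f f' := by
  have h1 := dualD_le_add_sum_dualSlope hΩc hα hμ hμΩ hμac hf hf'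
  have h2 : ∑ i, dualSlope Ω α μ f i (f' i - f i)
      ≤ ∑ i, partialGap Ω α μ f i * ‖weakGradLp Ω (f i - f' i)‖ := by
    refine Finset.sum_le_sum fun i _ => (le_abs_self _).trans ?_
    have := abs_dualSlope_le (i := i) hΩc hΩ hα hμ hμΩ hμac hf hM ((hw' i).sub hΩc (hw i))
      ((hf' i).sub (hf i))
    rwa [weakGradLp_sub hΩc hΩ (hw' i) (hw i), norm_sub_rev,
      ← weakGradLp_sub hΩc hΩ (hw i) (hw' i)] at this
  have h3 := Finset.sum_mul_sq_le_sq_mul_sq Finset.univ (partialGap Ω α μ f)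
    fun i => ‖weakGradLp Ω (f i - f' i)‖
  rw [← hdotDist_sq] at h3
  have h4 := mul_le_mul_of_nonneg_right (sum_sq_le_of_pushforwardGap_le hM).2
    (sq_nonneg (hdotDist Ω f f'))
  have h5 := abs_le_of_sq_le_sq ((h3.trans h4).trans_eq (mul_pow _ _ _).symm)
    (mul_nonneg M.2 hdotDist_nonneg)
  linarith [le_abs_self (∑ i, partialGap Ω α μ f i * ‖weakGradLp Ω (f i - f' i)‖)]

/-- One step of the ascent. A nonzero step size makes the gradient almost everywhere equal to a
difference quotient of continuous iterates, whence `IsSobolevGradient.norm_le` applies. -/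
theorem hdotDist_sq_step_le (hΩc : IsCompact Ω) (hΩ : Convex ℝ Ω)
    (hα : ∀ i, 0 < α i) (hμ : ∀ i, IsProbabilityMeasure (μ i)) (hμΩ : ∀ i, μ i Ωᶜ = 0)
    (hμac : ∀ i, μ i ≪ volume) (hf : ∀ i, ContinuousOn (f i) Ω)
    (hw : ∀ i, HasWeakGrad Ω (f i)) {M : ℝ≥0} (hM : pushforwardGap Ω α μ f ≤ M)
    {fnext : Fin n → EuclideanSpace ℝ (Fin d) → ℝ} (hfnext : ∀ i, ContinuousOn (fnext i) Ω)
    (hf' : ∀ i, ContinuousOn (f' i) Ω) (hw' : ∀ i, HasWeakGrad Ω (f' i)) {η : ℝ} (hη : 0 < η)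
    (hstep : ∀ i, ∃ g, IsSobolevGradient Ω α μ f i g ∧
      fnext i =ᵐ[volume.restrict Ω] fun x => f i x + η * g x) :
    (∀ i, HasWeakGrad Ω (fnext i)) ∧
      hdotDist Ω fnext f' ^ 2 ≤ hdotDist Ω f f' ^ 2
        - 2 * η * (dualD Ω α μ f' - dualD Ω α μ f) + η ^ 2 * (M : ℝ) ^ 2 := by
  choose g hg hae using hstep
  have hw1 : ∀ i, HasWeakGrad Ω (f i + η • g i) := fun i =>
    (hw i).add hΩc ((hg i).1.1.const_smul η)
  have hwn : ∀ i, HasWeakGrad Ω (fnext i) := fun i => (hw1 i).congr (hae i).symm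
  refine ⟨hwn, ?_⟩
  have hG : ∀ i, ‖weakGradLp Ω (g i)‖ ≤ partialGap Ω α μ f i := fun i => by
    refine (hg i).norm_le (g := η⁻¹ • (fnext i - f i)) hΩc hΩ hα hμ hμΩ hμac hf hM ?_
      (((hfnext i).sub (hf i)).const_smul _)
    filter_upwards [hae i] with x hx
    simp only [Pi.smul_apply, Pi.sub_apply, smul_eq_mul, hx]
    field_simp
    ring
  have hexp : ∀ i, ‖weakGradLp Ω (fnext i - f' i)‖ ^ 2
      ≤ ‖weakGradLp Ω (f i - f' i)‖ ^ 2 - 2 * η * dualSlope Ω α μ f i (f' i - f i)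
        + η ^ 2 * partialGap Ω α μ f i ^ 2 := fun i => by
    rw [← (hg i).hdotInner_eq hΩc hΩ hα hμ hμΩ hμac hf ((hw' i).sub hΩc (hw i))
        ((hf' i).sub (hf i)), hdotInner_eq_inner,
      weakGradLp_sub hΩc hΩ (hwn i) (hw' i), weakGradLp_sub hΩc hΩ (hw i) (hw' i),
      weakGradLp_sub hΩc hΩ (hw' i) (hw i), weakGradLp_congr hΩc hΩ (hw1 i) (hae i).symm,
      weakGradLp_add hΩc hΩ (hw i) ((hg i).1.1.const_smul η),
      weakGradLp_const_smul hΩc hΩ η (hg i).1.1, add_sub_right_comm, norm_add_sq_real,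
      inner_smul_right, norm_smul, mul_pow, Real.norm_eq_abs, sq_abs,
      ← neg_sub (weakGradLp Ω (f i)) (weakGradLp Ω (f' i)), inner_neg_right,
      real_inner_comm (weakGradLp Ω (g i))]
    have := mul_le_mul_of_nonneg_left (pow_le_pow_left₀ (norm_nonneg _) (hG i) 2) (sq_nonneg η)
    linarith
  have hsum := Finset.sum_le_sum fun i (_ : i ∈ Finset.univ) => hexp i
  rw [Finset.sum_add_distrib, Finset.sum_sub_distrib, ← Finset.mul_sum, ← Finset.mul_sum,
    ← hdotDist_sq, ← hdotDist_sq] at hsum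
  have h1 := dualD_le_add_sum_dualSlope hΩc hα hμ hμΩ hμac hf hf'
  have h2 := mul_le_mul_of_nonneg_left (sum_sq_le_of_pushforwardGap_le hM).2 (sq_nonneg η)
  have h3 := mul_le_mul_of_nonneg_left h1 (by positivity : 0 ≤ 2 * η)
  linarith

end Ascent

/-! ### Convergence rates -/

section Rates

theorem sqrt_le_sum_one_div_sqrt {T : ℕ} :
    √(T : ℝ) ≤ ∑ t ∈ Finset.range T, 1 / √((t : ℝ) + 1) := by
  have h : ∀ t ∈ Finset.range T, 1 / √(T : ℝ) ≤ 1 / √((t : ℝ) + 1) := fun t ht => by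
    have : (t : ℝ) + 1 ≤ T := by exact_mod_cast Finset.mem_range.1 ht
    gcongr
  calc √(T : ℝ) = ∑ t ∈ Finset.range T, 1 / √(T : ℝ) := by
        rw [Finset.sum_const, Finset.card_range, nsmul_eq_mul, mul_one_div, Real.div_sqrt]
    _ ≤ _ := Finset.sum_le_sum h

theorem sum_one_div_le_one_add_log (T : ℕ) :
    ∑ t ∈ Finset.range T, 1 / ((t : ℝ) + 1) ≤ 1 + Real.log T := by
  have := harmonic_le_one_add_log T
  simpa [harmonic] using this

theorem dualD_gap_mul_sum_le {d n : ℕ} {Ω : Set (EuclideanSpace ℝ (Fin d))}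
    (hΩc : IsCompact Ω) (hΩ : Convex ℝ Ω)
    {α : Fin (n + 1) → ℝ} (hα : ∀ i, 0 < α i)
    {μ : Fin (n + 1) → Measure (EuclideanSpace ℝ (Fin d))}
    (hμ : ∀ i, IsProbabilityMeasure (μ i)) (hμΩ : ∀ i, μ i Ωᶜ = 0) (hμac : ∀ i, μ i ≪ volume)
    {T : ℕ} {f : ℕ → Fin n → EuclideanSpace ℝ (Fin d) → ℝ}
    (hf0 : ∀ i, HasWeakGrad Ω (f 0 i)) (hf : ∀ t ≤ T, ∀ i, ContinuousOn (f t i) Ω)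
    {f' : Fin n → EuclideanSpace ℝ (Fin d) → ℝ}
    (hf' : ∀ i, ContinuousOn (f' i) Ω) (hw' : ∀ i, HasWeakGrad Ω (f' i))
    {M : ℝ≥0} (hM : ∀ t < T, pushforwardGap Ω α μ (f t) ≤ M)
    {η : ℕ → ℝ} (hη : ∀ t, 0 < η t) (hseq : IsSGASequence Ω α μ η T f)
    {B : ℝ} (hB : ∀ t < T, dualD Ω α μ (f t) ≤ B) :
    2 * (dualD Ω α μ f' - B) * ∑ t ∈ Finset.range T, η t
      ≤ hdotDist Ω (f 0) f' ^ 2 + (M : ℝ) ^ 2 * ∑ t ∈ Finset.range T, η t ^ 2 := by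
  have step := fun t (ht : t < T) (hw : ∀ i, HasWeakGrad Ω (f t i)) =>
    hdotDist_sq_step_le hΩc hΩ hα hμ hμΩ hμac (hf t ht.le) hw (hM t ht) (hf (t + 1) ht)
      hf' hw' (hη t) (hseq t ht)
  have hw : ∀ t ≤ T, ∀ i, HasWeakGrad Ω (f t i) := by
    intro t
    induction t with
    | zero => exact fun _ => hf0
    | succ t ih => exact fun ht => (step t ht (ih (by omega))).1
  refine two_mul_mul_sum_le_of_recursion (E := fun t => hdotDist Ω (f t) f' ^ 2)
    (fun t => sq_nonneg _) fun t ht => ((step t ht (hw t ht.le)).2).trans ?_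
  have := mul_le_mul_of_nonneg_left (sub_le_sub_left (hB t ht) (dualD Ω α μ f'))
    (by linarith [hη t] : 0 ≤ 2 * η t)
  linarith

end Rates

theorem theorem3 {d n : ℕ} (Ω : Set (EuclideanSpace ℝ (Fin d)))
    (hΩc : IsCompact Ω) (hΩ : Convex ℝ Ω)
    (α : Fin (n + 1) → ℝ) (hα : ∀ i, 0 < α i) (hα1 : ∑ i, α i = 1)
    (μ : Fin (n + 1) → Measure (EuclideanSpace ℝ (Fin d)))
    (hμ : ∀ i, IsProbabilityMeasure (μ i)) (hμΩ : ∀ i, μ i Ωᶜ = 0)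
    (hμac : ∀ i, μ i ≪ volume)
    (T : ℕ) (hT : 1 ≤ T)
    (f : ℕ → Fin n → EuclideanSpace ℝ (Fin d) → ℝ)
    (hf0 : ∀ i, HasWeakGrad Ω (f 0 i))
    (hf : ∀ t ≤ T, ∀ i, ContinuousOn (f t i) Ω)
    (ftilde : Fin n → EuclideanSpace ℝ (Fin d) → ℝ)
    (hftilde : ∀ i, IsCConcave Ω (ftilde i))
    (hmax : ∀ g : Fin n → EuclideanSpace ℝ (Fin d) → ℝ, (∀ i, ContinuousOn (g i) Ω) →
      dualD Ω α μ g ≤ dualD Ω α μ ftilde)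
    (M : ℝ≥0) (hM : ∀ t < T, pushforwardGap Ω α μ (f t) ≤ (M : ℝ≥0∞))
    (fbest : Fin n → EuclideanSpace ℝ (Fin d) → ℝ)
    (hbest : ∀ t < T, dualD Ω α μ (f t) ≤ dualD Ω α μ fbest) :
    (IsSGASequence Ω α μ (fun _ => hdotDist Ω (f 0) ftilde / ((M : ℝ) * √(T : ℝ))) T f →
      dualD Ω α μ ftilde - dualD Ω α μ fbest ≤
        (M : ℝ) * hdotDist Ω (f 0) ftilde * (1 / √(T : ℝ))) ∧
    (IsSGASequence Ω α μ (fun t => hdotDist Ω (f 0) ftilde / ((M : ℝ) * √((t : ℝ) + 1))) T f →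
      dualD Ω α μ ftilde - dualD Ω α μ fbest ≤
        (M : ℝ) * hdotDist Ω (f 0) ftilde * ((Real.log (T : ℝ) + 2) / √(T : ℝ))) := by
  have hne : Ω.Nonempty := by
    rw [nonempty_iff_ne_empty]
    rintro rfl
    have := hμ 0
    simpa using hμΩ 0
  have hlip := fun i => (hftilde i).exists_lipschitzOnWith hΩc hne
  have hf' : ∀ i, ContinuousOn (ftilde i) Ω := fun i => (hlip i).choose_spec.continuousOn
  have hw' : ∀ i, HasWeakGrad Ω (ftilde i) := fun i => (hlip i).choose_spec.hasWeakGrad hΩc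
  have hT0 : (0 : ℝ) < T := by exact_mod_cast hT
  have hsT : 0 < √(T : ℝ) := Real.sqrt_pos.2 hT0
  have hlog : 0 ≤ Real.log (T : ℝ) := Real.log_nonneg (by exact_mod_cast hT)
  have hR := hdotDist_nonneg (Ω := Ω) (f := f 0) (f' := ftilde)
  have hstart := dualD_sub_le_mul_hdotDist hΩc hΩ hα hμ hμΩ hμac (hf 0 (Nat.zero_le T)) hf' hf0 hw'
    (hM 0 hT)
  have hmain := fun (η : ℕ → ℝ) (hη : ∀ t, 0 < η t) (hseq : IsSGASequence Ω α μ η T f) =>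
    dualD_gap_mul_sum_le hΩc hΩ hα hμ hμΩ hμac hf0 hf hf' hw' hM hη hseq hbest
  have hb0 := hbest 0 hT
  set R := hdotDist Ω (f 0) ftilde
  set δ := dualD Ω α μ ftilde - dualD Ω α μ fbest with hδ
  rcases (mul_nonneg M.2 hR).eq_or_lt with hMR | hMR
  · -- All step sizes vanish, and already the initial iterate attains the maximal value.
    change 0 = (M : ℝ) * R at hMR
    rw [← hMR, zero_mul, zero_mul]
    exact ⟨fun _ => by linarith, fun _ => by linarith⟩
  have hM0 : 0 < (M : ℝ) := pos_of_mul_pos_left hMR hR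
  have hR0 : 0 < R := pos_of_mul_pos_right hMR M.2
  refine ⟨fun hseq => ?_, fun hseq => ?_⟩
  · have h := hmain _ (fun _ => by positivity) hseq
    simp only [Finset.sum_const, Finset.card_range, nsmul_eq_mul, div_pow, mul_pow,
      Real.sq_sqrt hT0.le] at h
    have e1 : 2 * δ * (T * (R / (M * √(T : ℝ)))) = 2 * R / M * (δ * √(T : ℝ)) := by
      nth_rewrite 1 [← Real.mul_self_sqrt hT0.le]
      field_simp
    have e2 : R ^ 2 + (M : ℝ) ^ 2 * (T * (R ^ 2 / ((M : ℝ) ^ 2 * T))) = 2 * R / M * (M * R) := by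
      field_simp
      ring
    rw [e1, e2] at h
    rw [mul_one_div, le_div_iff₀ hsT]
    exact le_of_mul_le_mul_left h (by positivity)
  · rw [← mul_div_assoc, le_div_iff₀ hsT]
    rcases le_or_gt δ 0 with hneg | hpos
    · exact (mul_nonpos_of_nonpos_of_nonneg hneg hsT.le).trans (by positivity)
    have h := hmain _ (fun _ => by positivity) hseq
    have e1 : ∑ t ∈ Finset.range T, R / (M * √((t : ℝ) + 1))
        = R / M * ∑ t ∈ Finset.range T, 1 / √((t : ℝ) + 1) := by
      rw [Finset.mul_sum]
      exact Finset.sum_congr rfl fun t _ => by field_simp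
    have e2 : (M : ℝ) ^ 2 * ∑ t ∈ Finset.range T, (R / (M * √((t : ℝ) + 1))) ^ 2
        = R ^ 2 * ∑ t ∈ Finset.range T, 1 / ((t : ℝ) + 1) := by
      rw [Finset.mul_sum, Finset.mul_sum]
      refine Finset.sum_congr rfl fun t _ => ?_
      rw [div_pow, mul_pow, Real.sq_sqrt (by positivity)]
      field_simp
    rw [e1, e2] at h
    have h1 : 2 * δ * (R / M * √(T : ℝ)) ≤ R ^ 2 + R ^ 2 * (1 + Real.log T) :=
      calc _ ≤ 2 * δ * (R / M * ∑ t ∈ Finset.range T, 1 / √((t : ℝ) + 1)) := by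
            gcongr
            exact sqrt_le_sum_one_div_sqrt
        _ ≤ _ := h
        _ ≤ _ := by
            gcongr
            exact sum_one_div_le_one_add_log T
    have e3 : 2 * δ * (R / M * √(T : ℝ)) = R / M * (2 * (δ * √(T : ℝ))) := by ring
    have e4 : R ^ 2 + R ^ 2 * (1 + Real.log T) = R / M * (M * R * (Real.log T + 2)) := by
      field_simp
      ring
    rw [e3, e4] at h1
    have h2 := le_of_mul_le_mul_left h1 (by positivity)
    have h3 : 0 ≤ δ * √(T : ℝ) := by positivity
    linarith
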